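/- Let $n\ge 1$ and let $X_1,\dots,X_n$ be independent non-negative random variables with finite first moment. For each $i$ let $X_i^1,\dots,X_i^n$ be independent random variables, each with the distribution of $X_i$ (a similar $n$-assembly), and put $M_i=\mathbb{E}\big[\max_{1\le j\le n}X_i^j\big]$ (its performance), $M_{(n)}=\max_{1\le i\le n}M_i$ and $X_{(n)}=\max_{1\le i\le n}X_i$. Assume $M_{(n)}\neq 0$, i.e. not all $X_i$ are almost surely $0$. Then the mixing factor $\theta_n=\mathbb{E}[X_{(n)}]/M_{(n)}$ satisfies $$\theta_n\le 2-\frac1n .$$ If moreover all similar $n$-assemblies perform equally, i.e. $M_1=\dots=M_n$, then $\theta_n\ge 1$. -/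

import Mathlib

open MeasureTheory ProbabilityTheory

/-- An `n`-assembly: `n` independent non-negative random variables with finite first moment. -/
structure IsAssembly {n : ℕ} {Ω : Type*} [MeasurableSpace Ω]
    (X : Fin n → Ω → ℝ) (μ : Measure Ω) : Prop where
  measurable : ∀ i, Measurable (X i)
  nonneg : ∀ i, ∀ᵐ ω ∂μ, 0 ≤ X i ω
  integrable : ∀ i, Integrable (X i) μ
  indep : iIndepFun X μ

/-- A similar `n`-assembly: an `n`-assembly whose members are identically distributed. -/
structure IsSimilarAssembly {n : ℕ} {Ω : Type*} [MeasurableSpace Ω]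
    (X : Fin n → Ω → ℝ) (μ : Measure Ω) : Prop extends IsAssembly X μ where
  identDistrib : ∀ j k, IdentDistrib (X j) (X k) μ μ

/-- The maximum `x₁ ∨ … ∨ xₙ` of a non-empty finite sequence of reals. -/
noncomputable def maxOf {n : ℕ} [NeZero n] (x : Fin n → ℝ) : ℝ :=
  Finset.univ.sup' Finset.univ_nonempty x

/-- The performance of an `n`-assembly: the expected value of its maximum. -/
noncomputable def performance {n : ℕ} [NeZero n] {Ω : Type*} [MeasurableSpace Ω]
    (X : Fin n → Ω → ℝ) (μ : Measure Ω) : ℝ :=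
  ∫ ω, maxOf (fun i => X i ω) ∂μ

/-- The largest performance `M_(n) = M₁ ∨ … ∨ Mₙ` among the assemblies `Y 1, …, Y n`, where
the assembly `Y i` consists of `Y i 1, …, Y i n`. -/
noncomputable def maxPerformance {n : ℕ} [NeZero n] {Ω : Fin n → Type*}
    [∀ i, MeasurableSpace (Ω i)] (Y : (i : Fin n) → Fin n → Ω i → ℝ)
    (ν : (i : Fin n) → Measure (Ω i)) : ℝ :=
  maxOf (fun i => performance (Y i) (ν i))

/-- The mixing factor `θₙ = E[X_(n)] / M_(n)` of the assembly `X` drawn from the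
similar assemblies `Y 1, …, Y n`. -/
noncomputable def mixingFactor {n : ℕ} [NeZero n] {Ω : Type*} [MeasurableSpace Ω]
    {Ω' : Fin n → Type*} [∀ i, MeasurableSpace (Ω' i)]
    (X : Fin n → Ω → ℝ) (μ : Measure Ω)
    (Y : (i : Fin n) → Fin n → Ω' i → ℝ) (ν : (i : Fin n) → Measure (Ω' i)) : ℝ :=
  performance X μ / maxPerformance Y ν

/-! Upper bound: for any level `c`, the maximum is at most `c` plus the sum of the excesses `(X i -
c)⁺`. With `c = (1 - 1/n) M`, each expected excess is at most `M / n` (`integral_excess_le`), so the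
total is at most `c + M`. The excess bound compares the maximum of `n` copies of one variable with
the payoff of stopping at the first value above `c`.

Lower bound: `P(max > t)` is `1 - ∏ F i t` for the mixed assembly and `1 - (F i t) ^ n` for the
similar ones. AM-GM at each `t`, integrated over `t`, shows that the mixed performance is at least
the average of the similar ones. -/

open Finset in
/-- The geometric mean of `n` non-negative numbers is at most the mean of their `n`-th powers. -/
lemma card_mul_prod_le_sum_pow {n : ℕ} (hn : n ≠ 0) (a : Fin n → ℝ) (ha : ∀ i, 0 ≤ a i) :
    (n : ℝ) * ∏ i, a i ≤ ∑ i, a i ^ n := by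
  have hn0 : (n : ℝ) ≠ 0 := Nat.cast_ne_zero.2 hn
  have h := Real.geom_mean_le_arith_mean_weighted (univ : Finset (Fin n))
    (fun _ => (n : ℝ)⁻¹) (fun i => a i ^ n) (fun _ _ => by positivity)
    (by simp [hn0]) (fun i _ => pow_nonneg (ha i) n)
  simp only [Real.pow_rpow_inv_natCast (ha _) hn, ← mul_sum] at h
  calc (n : ℝ) * ∏ i, a i ≤ n * ((n : ℝ)⁻¹ * ∑ i, a i ^ n) := by gcongr
    _ = ∑ i, a i ^ n := by field_simp

/-- On `[0, 1]` the geometric sum `1 + x + ⋯ + x ^ (n - 1)` is at least `1 + (n - 1) * x ^ n`. -/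
lemma one_add_mul_pow_le_sum_pow {n : ℕ} (hn : n ≠ 0) {x : ℝ} (h0 : 0 ≤ x) (h1 : x ≤ 1) :
    1 + ((n : ℝ) - 1) * x ^ n ≤ ∑ j : Fin n, x ^ (j : ℕ) := by
  obtain ⟨m, rfl⟩ := Nat.exists_eq_succ_of_ne_zero hn
  rw [Fin.sum_univ_succ]
  have : ∑ _j : Fin m, x ^ (m + 1) ≤ ∑ j : Fin m, x ^ ((j.succ : Fin (m + 1)) : ℕ) :=
    Finset.sum_le_sum fun j _ => pow_le_pow_of_le_one h0 h1 (by simp)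
  simp at this ⊢
  linarith

/-! ### Pointwise bounds on the maximum; the threshold stopping rule -/

section maxOf

variable {n : ℕ}

/-- The `k`-th factor of the payoff of the rule that stops at the first value exceeding `c`,
on the event that it stops at time `j`. -/
noncomputable def firstExceedanceFactor (c : ℝ) (j k : Fin n) (y : ℝ) : ℝ :=
  if k < j then (if y ≤ c then 1 else 0) else if k = j then (if c < y then y else 0) else 1

lemma measurable_firstExceedanceFactor (c : ℝ) (j k : Fin n) :
    Measurable (firstExceedanceFactor c j k) := by
  unfold firstExceedanceFactor
  split_ifs
  · exact Measurable.ite measurableSet_Iic measurable_const measurable_const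
  · exact Measurable.ite measurableSet_Ioi measurable_id measurable_const
  · exact measurable_const

/-- Writing the payoff as a product of one-variable functions lets independence factor its
expectation. -/
lemma prod_firstExceedanceFactor (c : ℝ) (j : Fin n) (y : Fin n → ℝ) :
    ∏ k, firstExceedanceFactor c j k (y k) =
      if (∀ k < j, y k ≤ c) ∧ c < y j then y j else 0 := by
  split_ifs with h
  · have : ∀ k, firstExceedanceFactor c j k (y k) = if k = j then y k else 1 := by
      intro k
      unfold firstExceedanceFactor
      by_cases hk : k < j
      · simp [hk, h.1 k hk, hk.ne]
      · by_cases hkj : k = j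
        · subst hkj; simp [h.2]
        · simp [hk, hkj]
    simp [this]
  · rw [not_and_or] at h
    rcases h with h | h
    · push Not at h
      obtain ⟨k, hk, hc⟩ := h
      exact Finset.prod_eq_zero (Finset.mem_univ k)
        (by simp [firstExceedanceFactor, hk, hc])
    · exact Finset.prod_eq_zero (Finset.mem_univ j) (by simp [firstExceedanceFactor, h])

variable [NeZero n]

lemma le_maxOf (y : Fin n → ℝ) (i : Fin n) : y i ≤ maxOf y :=
  Finset.le_sup' y (Finset.mem_univ i)

lemma maxOf_le_iff {y : Fin n → ℝ} {t : ℝ} : maxOf y ≤ t ↔ ∀ i, y i ≤ t := by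
  simp [maxOf]

lemma exists_eq_maxOf (y : Fin n → ℝ) : ∃ i, maxOf y = y i := by
  obtain ⟨i, -, h⟩ := Finset.exists_mem_eq_sup' Finset.univ_nonempty y
  exact ⟨i, h⟩

lemma maxOf_le_add_sum (y : Fin n → ℝ) (c : ℝ) : maxOf y ≤ c + ∑ i, max (y i - c) 0 := by
  refine maxOf_le_iff.2 fun i => ?_
  have := Finset.single_le_sum (f := fun i => max (y i - c) 0) (fun j _ => le_max_right _ _)
    (Finset.mem_univ i)
  have h2 := le_max_left (y i - c) 0
  linarith

/-- Stopping at the first value exceeding `c` gains at most the maximum. -/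
lemma sum_prod_firstExceedanceFactor_le (c : ℝ) (y : Fin n → ℝ) (hy : ∀ i, 0 ≤ y i) :
    ∑ j, ∏ k, firstExceedanceFactor c j k (y k) ≤ maxOf y := by
  simp only [prod_firstExceedanceFactor]
  by_cases h : ∃ j, (∀ k < j, y k ≤ c) ∧ c < y j
  · obtain ⟨j, hj⟩ := h
    rw [Finset.sum_eq_single j]
    · rw [if_pos hj]; exact le_maxOf y j
    · intro i _ hij
      rw [if_neg]
      rintro ⟨h1, h2⟩
      rcases lt_or_gt_of_ne hij with h | h
      · exact (hj.1 i h).not_gt h2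
      · exact (h1 j h).not_gt hj.2
    · simp
  · push Not at h
    rw [Finset.sum_eq_zero]
    · exact (hy 0).trans (le_maxOf y 0)
    · intro j _
      rw [if_neg]
      exact fun hj => (h j hj.1).not_gt hj.2

end maxOf

/-! ### Performance of a single assembly -/

namespace IsAssembly

variable {n : ℕ} [NeZero n] {Ω : Type*} [MeasurableSpace Ω] {W : Fin n → Ω → ℝ} {μ : Measure Ω}

lemma measurable_maxOf (hW : IsAssembly W μ) : Measurable fun ω => maxOf fun i => W i ω := by
  have := Finset.measurable_sup' (f := W) Finset.univ_nonempty fun i _ => hW.measurable i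
  convert! this using 2 with ω
  simp [maxOf, Finset.sup'_apply]

lemma maxOf_nonneg (hW : IsAssembly W μ) : ∀ᵐ ω ∂μ, 0 ≤ maxOf fun i => W i ω := by
  filter_upwards [hW.nonneg 0] with ω h
  exact h.trans (le_maxOf (fun i => W i ω) 0)

lemma integrable_maxOf (hW : IsAssembly W μ) : Integrable (fun ω => maxOf fun i => W i ω) μ := by
  refine (integrable_finsetSum Finset.univ fun i _ => (hW.integrable i).abs).mono'
    hW.measurable_maxOf.aestronglyMeasurable (ae_of_all _ fun ω => ?_)
  obtain ⟨i, hi⟩ := exists_eq_maxOf fun i => W i ω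
  rw [hi]
  exact Finset.single_le_sum (f := fun i => |W i ω|) (fun j _ => abs_nonneg _) (Finset.mem_univ i)

lemma performance_nonneg (hW : IsAssembly W μ) : 0 ≤ performance W μ :=
  integral_nonneg_of_ae hW.maxOf_nonneg

lemma ofReal_performance (hW : IsAssembly W μ) :
    ENNReal.ofReal (performance W μ) =
      ∫⁻ t in Set.Ioi 0, μ {ω | t < maxOf fun i => W i ω} := by
  rw [performance, ofReal_integral_eq_lintegral_ofReal hW.integrable_maxOf hW.maxOf_nonneg]
  exact lintegral_eq_lintegral_meas_lt μ hW.maxOf_nonneg hW.measurable_maxOf.aemeasurable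

/-- The left side is the expected payoff of the threshold rule: index `j` (from `0`) is reached when
the `j` earlier values are all at most `c`. -/
lemma sum_pow_mul_le_performance (hW : IsAssembly W μ) {Ω₀ : Type*} [MeasurableSpace Ω₀]
    {μ₀ : Measure Ω₀} {Z : Ω₀ → ℝ} (hWZ : ∀ i, IdentDistrib (W i) Z μ μ₀)
    [IsProbabilityMeasure μ₀] (hZ : Measurable Z) (c : ℝ) :
    (∑ j : Fin n, μ₀.real (Z ⁻¹' Set.Iic c) ^ (j : ℕ)) * ∫ ω, (if c < Z ω then Z ω else 0) ∂μ₀ ≤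
      performance W μ := by
  have hint : ∀ j, Integrable
      (fun ω => ∏ k, firstExceedanceFactor c j k (W k ω)) μ := fun j => by
    refine (hW.integrable j).mono (Finset.measurable_prod _ fun k _ =>
      (measurable_firstExceedanceFactor c j k).comp (hW.measurable k)).aestronglyMeasurable
      (ae_of_all _ fun ω => ?_)
    rw [prod_firstExceedanceFactor c j fun k => W k ω]
    split_ifs <;> simp
  have hval : ∀ j : Fin n, ∫ ω, ∏ k, firstExceedanceFactor c j k (W k ω) ∂μ =
      μ₀.real (Z ⁻¹' Set.Iic c) ^ (j : ℕ) * ∫ ω, (if c < Z ω then Z ω else 0) ∂μ₀ := fun j => by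
    rw [hW.indep.integral_fun_prod_comp (fun i => (hW.measurable i).aemeasurable)
      fun k => (measurable_firstExceedanceFactor c j k).aestronglyMeasurable]
    have hk : ∀ k, ∫ ω, firstExceedanceFactor c j k (W k ω) ∂μ =
        (if k < j then μ₀.real (Z ⁻¹' Set.Iic c) else 1) *
          (if k = j then ∫ ω, (if c < Z ω then Z ω else 0) ∂μ₀ else 1) := fun k => by
      have := ((hWZ k).comp (measurable_firstExceedanceFactor c j k)).integral_eq
      simp only [Function.comp_def] at this
      rw [this]
      unfold firstExceedanceFactor
      by_cases hkj : k < j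
      · simp only [hkj, hkj.ne, if_true, if_false, mul_one]
        rw [← integral_indicator_one (hZ measurableSet_Iic)]
        rfl
      · by_cases hkj' : k = j <;> simp [hkj, hkj']
    simp only [hk, Finset.prod_mul_distrib, Finset.prod_ite_eq', Finset.mem_univ, if_true]
    rw [Finset.prod_ite, Finset.prod_const, Finset.prod_const_one, mul_one,
      Finset.filter_gt_eq_Iio, Fin.card_Iio]
  rw [Finset.sum_mul]
  simp only [← hval]
  rw [← integral_finsetSum _ fun j _ => hint j]
  refine integral_mono_ae (integrable_finsetSum _ fun j _ => hint j) hW.integrable_maxOf ?_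
  filter_upwards [ae_all_iff.2 hW.nonneg] with ω h
  exact sum_prod_firstExceedanceFactor_le c (fun k => W k ω) h

/-- If `n` independent copies of `Z` have expected maximum at most `M`, then the expected excess
of `Z` over `(1 - 1 / n) * M` is at most `M / n`. -/
lemma integral_excess_le (hW : IsAssembly W μ) {Ω₀ : Type*} [MeasurableSpace Ω₀]
    {μ₀ : Measure Ω₀} {Z : Ω₀ → ℝ} (hWZ : ∀ i, IdentDistrib (W i) Z μ μ₀)
    [IsProbabilityMeasure μ₀] (hZ : Measurable Z) (hZi : Integrable Z μ₀)
    {M : ℝ} (hM : performance W μ ≤ M) :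
    ∫ ω, max (Z ω - (1 - 1 / n) * M) 0 ∂μ₀ ≤ M / n := by
  set c : ℝ := (1 - 1 / n) * M with hc
  set x := μ₀.real (Z ⁻¹' Set.Iic c) with hx
  set A := ∫ ω, max (Z ω - c) 0 ∂μ₀
  have hn : (0 : ℝ) < n := Nat.cast_pos.2 (NeZero.pos n)
  have hM0 : 0 ≤ M := hW.performance_nonneg.trans hM
  have hx0 : 0 ≤ x := measureReal_nonneg
  have hx1 : x ≤ 1 := measureReal_le_one
  -- Where `Z > c`, split `Z` as `(Z - c) + c`.
  have hB : ∫ ω, (if c < Z ω then Z ω else 0) ∂μ₀ = A + c * (1 - x) := by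
    have hm : MeasurableSet (Z ⁻¹' Set.Iic c)ᶜ := (hZ measurableSet_Iic).compl
    have h1 : ∀ ω, (if c < Z ω then Z ω else 0) =
        max (Z ω - c) 0 + c * (Z ⁻¹' Set.Iic c)ᶜ.indicator 1 ω := fun ω => by
      by_cases h : c < Z ω
      · simp [h, h.le]
      · simp [h, not_lt.1 h]
    simp only [h1]
    have h2 : Integrable (fun ω => max (Z ω - c) 0) μ₀ :=
      (hZi.sub (integrable_const c)).sup (integrable_const 0)
    have h3 : Integrable (fun ω => c * (Z ⁻¹' Set.Iic c)ᶜ.indicator 1 ω) μ₀ :=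
      ((integrable_const (1 : ℝ)).indicator hm).const_mul c
    rw [integral_add h2 h3, integral_const_mul,
      integral_indicator_one hm, probReal_compl_eq_one_sub (hZ measurableSet_Iic)]
  have h := (hW.sum_pow_mul_le_performance hWZ hZ c).trans hM
  rw [hB, ← hx] at h
  have hgeom : (∑ j : Fin n, x ^ (j : ℕ)) * (1 - x) = 1 - x ^ n := by
    rw [Fin.sum_univ_eq_sum_range (fun j => x ^ j)]
    linarith [geom_sum_mul x n]
  have hS := one_add_mul_pow_le_sum_pow (NeZero.ne n) hx0 hx1
  set S := ∑ j : Fin n, x ^ (j : ℕ)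
  have hS1 : 0 < S := by
    have h1n : (1 : ℝ) ≤ n := Nat.one_le_cast.2 (NeZero.pos n)
    have : 0 ≤ ((n : ℝ) - 1) * x ^ n := mul_nonneg (by linarith) (pow_nonneg hx0 n)
    linarith
  refine le_of_mul_le_mul_left ?_ hS1
  calc S * A = S * (A + c * (1 - x)) - c * (S * (1 - x)) := by ring
    _ ≤ M - c * (1 - x ^ n) := by rw [hgeom]; linarith
    -- The choice of `c` gives `M - c = M / n` and `c = (n - 1) * (M / n)`, so `M / n` factors out.
    _ = (1 + ((n : ℝ) - 1) * x ^ n) * (M / n) := by rw [hc]; field_simp; ring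
    _ ≤ S * (M / n) := by gcongr

variable [IsProbabilityMeasure μ]

lemma measureReal_lt_maxOf (hW : IsAssembly W μ) (t : ℝ) :
    μ.real {ω | t < maxOf fun i => W i ω} = 1 - ∏ i, μ.real (W i ⁻¹' Set.Iic t) := by
  have h := hW.indep.measure_inter_preimage_eq_mul Finset.univ
    (sets := fun _ => Set.Iic t) fun _ _ => measurableSet_Iic
  have hs : {ω | t < maxOf fun i => W i ω} = (⋂ i ∈ Finset.univ, W i ⁻¹' Set.Iic t)ᶜ := by
    ext ω
    simp only [Set.mem_ofPred_eq, ← not_le, maxOf_le_iff]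
    simp
  rw [hs, probReal_compl_eq_one_sub
    (Finset.measurableSet_biInter _ fun i _ => hW.measurable i measurableSet_Iic),
    measureReal_def, h, ENNReal.toReal_prod]
  rfl

end IsAssembly

/-! ### Comparing the mixed assembly with the similar ones -/

section Mixing

variable {n : ℕ} [NeZero n]
  {Ω : Type*} [MeasurableSpace Ω] {μ : Measure Ω} [IsProbabilityMeasure μ]
  {Ω' : Fin n → Type*} [∀ i, MeasurableSpace (Ω' i)]
  {ν : (i : Fin n) → Measure (Ω' i)}
  {X : Fin n → Ω → ℝ} {Y : (i : Fin n) → Fin n → Ω' i → ℝ}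

lemma performance_le_mul_of_performance_le (hX : IsAssembly X μ)
    (hY : ∀ i, IsAssembly (Y i) (ν i)) (hYX : ∀ i j, IdentDistrib (Y i j) (X i) (ν i) μ)
    {M : ℝ} (hM : ∀ i, performance (Y i) (ν i) ≤ M) :
    performance X μ ≤ (2 - 1 / n) * M := by
  have hn : (n : ℝ) ≠ 0 := Nat.cast_ne_zero.2 (NeZero.ne n)
  set c : ℝ := (1 - 1 / n) * M with hc
  have hint : ∀ i, Integrable (fun ω => max (X i ω - c) 0) μ := fun i =>
    ((hX.integrable i).sub (integrable_const c)).sup (integrable_const 0)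
  have hsum : ∑ i, ∫ ω, max (X i ω - c) 0 ∂μ ≤ ∑ _i : Fin n, M / n :=
    Finset.sum_le_sum fun i _ =>
      (hY i).integral_excess_le (hYX i) (hX.measurable i) (hX.integrable i) (hM i)
  calc performance X μ ≤ ∫ ω, (c + ∑ i, max (X i ω - c) 0) ∂μ :=
        integral_mono hX.integrable_maxOf
          ((integrable_const c).add (integrable_finsetSum _ fun i _ => hint i))
          fun ω => maxOf_le_add_sum (fun i => X i ω) c
    _ = c + ∑ i, ∫ ω, max (X i ω - c) 0 ∂μ := by
        rw [integral_add (integrable_const c) (integrable_finsetSum _ fun i _ => hint i),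
          integral_finsetSum _ fun i _ => hint i]
        simp
    _ ≤ c + ∑ _i : Fin n, M / n := by gcongr
    _ = (2 - 1 / n) * M := by
        rw [Finset.sum_const, Finset.card_univ, Fintype.card_fin, nsmul_eq_mul, hc]
        field_simp
        ring

lemma sum_performance_le [∀ i, IsProbabilityMeasure (ν i)] (hX : IsAssembly X μ)
    (hY : ∀ i, IsAssembly (Y i) (ν i)) (hYX : ∀ i j, IdentDistrib (Y i j) (X i) (ν i) μ) :
    ∑ i, performance (Y i) (ν i) ≤ n * performance X μ := by
  have hX0 := hX.performance_nonneg
  have hmeas : ∀ i, Measurable fun t : ℝ => ν i {ω | t < maxOf fun j => Y i j ω} := fun i =>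
    Antitone.measurable fun s t hst => measure_mono fun ω hω => lt_of_le_of_lt hst hω
  have hmeas' : Measurable fun t : ℝ => μ {ω | t < maxOf fun i => X i ω} :=
    Antitone.measurable fun s t hst => measure_mono fun ω hω => lt_of_le_of_lt hst hω
  -- Write every performance as the integral of its tail, so that the claim can be checked at each
  -- `t`.
  rw [← ENNReal.ofReal_le_ofReal_iff (by positivity),
    ENNReal.ofReal_sum_of_nonneg fun i _ => (hY i).performance_nonneg,
    ENNReal.ofReal_mul (by positivity), hX.ofReal_performance]
  simp only [fun i => (hY i).ofReal_performance]
  rw [← lintegral_finsetSum _ fun i _ => hmeas i, ← lintegral_const_mul _ hmeas']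
  refine lintegral_mono fun t => ?_
  rw [← ofReal_measureReal (μ := μ),
    Finset.sum_congr rfl fun i _ => (ofReal_measureReal (μ := ν i)).symm,
    ← ENNReal.ofReal_sum_of_nonneg fun i _ => measureReal_nonneg,
    ← ENNReal.ofReal_mul (by positivity)]
  refine ENNReal.ofReal_le_ofReal ?_
  have hF : ∀ i j, (ν i).real (Y i j ⁻¹' Set.Iic t) = μ.real (X i ⁻¹' Set.Iic t) := fun i j => by
    rw [measureReal_def, (hYX i j).measure_mem_eq measurableSet_Iic, measureReal_def]
  simp only [fun i => (hY i).measureReal_lt_maxOf t, hX.measureReal_lt_maxOf t, hF,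
    Finset.prod_const, Finset.card_univ, Fintype.card_fin, Finset.sum_sub_distrib,
    Finset.sum_const, nsmul_eq_mul, mul_one, mul_sub]
  linarith [card_mul_prod_le_sum_pow (NeZero.ne n) (fun i => μ.real (X i ⁻¹' Set.Iic t))
    fun i => measureReal_nonneg]

end Mixing

theorem corollary2p2 {n : ℕ} [NeZero n]
    {Ω : Type*} [MeasurableSpace Ω] (μ : Measure Ω) [IsProbabilityMeasure μ]
    {Ω' : Fin n → Type*} [∀ i, MeasurableSpace (Ω' i)]
    (ν : (i : Fin n) → Measure (Ω' i)) [∀ i, IsProbabilityMeasure (ν i)]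
    (X : Fin n → Ω → ℝ) (hX : IsAssembly X μ)
    -- `Y i j` is the `j`-th member of the `i`-th similar assembly
    (Y : (i : Fin n) → Fin n → Ω' i → ℝ) (hY : ∀ i, IsSimilarAssembly (Y i) (ν i))
    (hYX : ∀ i j, IdentDistrib (Y i j) (X i) (ν i) μ)
    -- the denominator of the mixing factor does not vanish
    (hM : maxPerformance Y ν ≠ 0) :
    mixingFactor X μ Y ν ≤ 2 - 1 / (n : ℝ) ∧
      ((∀ i k, performance (Y i) (ν i) = performance (Y k) (ν k)) →
        1 ≤ mixingFactor X μ Y ν) := by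
  have hY' : ∀ i, IsAssembly (Y i) (ν i) := fun i => (hY i).toIsAssembly
  have hle : ∀ i, performance (Y i) (ν i) ≤ maxPerformance Y ν :=
    le_maxOf fun i => performance (Y i) (ν i)
  have hpos : 0 < maxPerformance Y ν :=
    lt_of_le_of_ne ((hY' 0).performance_nonneg.trans (hle 0)) hM.symm
  refine ⟨(div_le_iff₀ hpos).2 (performance_le_mul_of_performance_le hX hY' hYX hle), fun heq => ?_⟩
  rw [mixingFactor, one_le_div hpos]
  obtain ⟨i, hi⟩ := exists_eq_maxOf fun i => performance (Y i) (ν i)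
  have hsum := sum_performance_le hX hY' hYX
  simp only [fun k => heq k i, Finset.sum_const, Finset.card_univ, Fintype.card_fin,
    nsmul_eq_mul] at hsum
  rw [maxPerformance, hi]
  exact le_of_mul_le_mul_left hsum (Nat.cast_pos.2 (NeZero.pos n))
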